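/- **Setting.** Let $G=\bigoplus_{(p,r,m)}\mathbb Z_{p^r}^{(m)}$ be a finite abelian group, decomposed into primary cyclic rings ($p$ prime, $r\ge 1$). Let $r_p$ be the largest exponent occurring with $p$ and $\mathcal S=\{(p,s): p\mid |G|,\ 1\le s\le r_p\}$. Let $J=\bigoplus_{(p,s)\in\mathcal S}\mathbb Z_{p^s}^{k_{p,s}}$ with integers $k_{p,s}\ge 0$, not all zero, and let $\{\rho_x\}_{x\in G}$ be a CQ channel: density operators on a finite-dimensional Hilbert space $\mathcal B$. A *$(1,|J|,\tau)$ group transmission system* consists of a homomorphism $\phi:J\to G$, a shift $v\in G$ and a POVM $\{\Lambda_a\}_{a\in J}$ on $\mathcal B$ such that, for the encoder $a\mapsto\phi(a)+v$, $$\frac1{|J|}\sum_{a\in J}\bigl(1-\mathrm{tr}[\Lambda_a\,\rho_{\phi(a)+v}]\bigr)\le\tau .$$ Its rate is $R=\log_2|J|$. Let $\hat\theta$ range over the integer vectors $(\hat\theta_{p,s})_{(p,s)\in\mathcal S}$ with $0\le\hat\theta_{p,s}\le s$, and let $\mathbf s$ be the vector with $\mathbf s_{p,s}=s$. Let $|T_{\hat\theta}|$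 be the number of $u\in J$ such that, for every $(p,s)$, $u_{p,s}\in p^{\hat\theta_{p,s}}\mathbb Z_{p^s}^{k_{p,s}}\setminus p^{\hat\theta_{p,s}+1}\mathbb Z_{p^s}^{k_{p,s}}$ (read as $\{0\}$ if $\hat\theta_{p,s}=s$). Let $\eta$ range over the integer vectors $(\eta_{p,r,m,s})_{1\le s\le r_p}$ with $0\le\eta_{p,r,m,s}\le r-|r-s|^+$, and $b$ over $G$. Put $$H_\eta=\bigoplus_{(p,r,m)}p^{\min_s(|r-s|^++\eta_{p,r,m,s})}\mathbb Z_{p^r}^{(m)},\qquad H_{\eta+\hat\theta}=\bigoplus_{(p,r,m)}p^{\min_s(|r-s|^++\eta_{p,r,m,s}+\hat\theta_{p,s})}\mathbb Z_{p^r}^{(m)},$$ where the minima are over those $s\in\{1,\dots,r_p\}$ with $k_{p,s}\neq0$ (the summand is $0$ if there is no such $s$). Define $$\pi^{AB}_{\eta,b}=\sum_{x\in H_\eta+b}\tfrac1{|H_\eta|}|x\rangle\langle x|\otimes\rho_x,\qquad \pi^{AB}_{\eta,b,\hat\theta}=\sum_{x\in H_\eta+b}\tfrac1{|H_\eta|}\sum_{\tilde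 x\in x+H_{\eta+\hat\theta}}\tfrac1{|H_{\eta+\hat\theta}|}|\tilde x\rangle\langle\tilde x|\otimes\rho_x,$$ $$\pi^{AB}_{\eta,b,J}=\frac1{|J|-1}\sum_{\hat\theta\ne\mathbf s}|T_{\hat\theta}|\,\pi^{AB}_{\eta,b,\hat\theta},\qquad D_H^\epsilon(\rho\|\sigma)=-\log_2\inf_{0\le\Lambda\le I,\ \mathrm{tr}[\Lambda\rho]\ge1-\epsilon}\mathrm{tr}[\Lambda\sigma].$$ **Theorem.** There exist $\epsilon'\in[0,1]$ and a $(1,|J|,\epsilon')$ group transmission system such that, for every $\epsilon\in(0,\epsilon')$, $$R=\log_2|J|\ \ge\ \max_{\eta,b}D_H^\epsilon\bigl(\pi^{AB}_{\eta,b}\,\big\|\,\pi^{AB}_{\eta,b,J}\bigr)-\log_2\frac{4\epsilon'}{(\epsilon'-\epsilon)^2}.$$ Moreover, whenever $0<\epsilon<\epsilon'<1$ are given and $$\log_2|J|\ \le\ \max_{\eta,b}D_H^\epsilon\bigl(\pi^{AB}_{\eta,b}\,\big\|\,\pi^{AB}_{\eta,b,J}\bigr)-\log_2\frac{4\epsilon'}{(\epsilon'-\epsilon)^2},$$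 there exists a $(1,|J|,\epsilon')$ group transmission system. -/

import Mathlib

open scoped Kronecker ComplexOrder

noncomputable section

/-- A decomposition of the abelian group `G` into primary cyclic rings: `ι` is the set of
triples `(p, r, m)`, and the ring with index `i` is `ZMod (p i ^ r i)`. Several indices may
carry the same pair `(p, r)`. -/
structure PrimaryDecomposition (ι G : Type*) [AddCommGroup G] where
  /-- the prime of the ring with index `i` -/
  p : ι → ℕ
  /-- the exponent of the ring with index `i` -/
  r : ι → ℕ
  prime : ∀ i, (p i).Prime
  one_le : ∀ i, 1 ≤ r i
  /-- the identification of `G` with the direct sum -/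
  equiv : G ≃+ ((i : ι) → ZMod (p i ^ r i))

namespace PrimaryDecomposition

variable {ι G : Type*} [Fintype ι] [AddCommGroup G]

/-- The index set `{(q, s) | q divides |G|, 1 ≤ s ≤ r_q}`, where `r_q` is the largest exponent
occurring with the prime `q`. -/
def pairs (D : PrimaryDecomposition ι G) : Finset (ℕ × ℕ) :=
  Finset.univ.biUnion fun i => (Finset.Icc 1 (D.r i)).image fun s => (D.p i, s)

lemma prime_of_mem_pairs (D : PrimaryDecomposition ι G) (σ : D.pairs) : (σ.1.1).Prime := by
  obtain ⟨⟨q, s⟩, hσ⟩ := σ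
  simp only [pairs, Finset.mem_biUnion, Finset.mem_image, Prod.mk.injEq] at hσ
  obtain ⟨i, -, t, -, h, -⟩ := hσ
  exact h ▸ D.prime i

instance neZero_pow (D : PrimaryDecomposition ι G) (σ : D.pairs) :
    NeZero (σ.1.1 ^ σ.1.2) :=
  ⟨pow_ne_zero _ (D.prime_of_mem_pairs σ).ne_zero⟩

/-- The message group `J`: the direct sum of the groups `(ZMod (q ^ s)) ^ k_{q,s}`. -/
abbrev MessageGroup (D : PrimaryDecomposition ι G) (k : D.pairs → ℕ) : Type :=
  (σ : D.pairs) → Fin (k σ) → ZMod (σ.1.1 ^ σ.1.2)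

/-- The vectors `θ̂` with `0 ≤ θ̂_{q,s} ≤ s`. -/
abbrev Theta (D : PrimaryDecomposition ι G) : Type :=
  (σ : D.pairs) → Fin (σ.1.2 + 1)

/-- The vector whose component with index `(q, s)` is `s`. -/
def fullTheta (D : PrimaryDecomposition ι G) : D.Theta := fun σ => Fin.last σ.1.2

/-- The vectors `η`, indexed by `(p, r, m) = i` and by `s` with `1 ≤ s ≤ r_p`, with
`0 ≤ η_{p,r,m,s} ≤ r - |r - s|⁺` (truncated subtraction of natural numbers is `|r - s|⁺`). -/
abbrev Eta (D : PrimaryDecomposition ι G) : Type _ :=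
  (i : ι) → (σ : {σ : D.pairs // σ.1.1 = D.p i}) → Fin (D.r i - (D.r i - σ.1.1.2) + 1)

/-- `q ^ t • (ZMod (q ^ s)) ^ n` without `q ^ (t + 1) • (ZMod (q ^ s)) ^ n`, with the convention
that this is `{0}` for `t = s`. -/
def layer (q s n t : ℕ) : Set (Fin n → ZMod (q ^ s)) :=
  if t = s then {0}
  else {v | (∃ w : Fin n → ZMod (q ^ s), v = (q ^ t) • w) ∧
    ¬ ∃ w : Fin n → ZMod (q ^ s), v = (q ^ (t + 1)) • w}

/-- The set `T_θ̂(a)`. -/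
def typeSet (D : PrimaryDecomposition ι G) {k : D.pairs → ℕ} (θ : D.Theta)
    (a : D.MessageGroup k) : Set (D.MessageGroup k) :=
  {a' | ∀ σ, a' σ - a σ ∈ layer σ.1.1 σ.1.2 (k σ) (θ σ)}

/-- The cardinality of `T_θ̂(a)`, which is the same for all `a`. -/
def typeCard (D : PrimaryDecomposition ι G) (k : D.pairs → ℕ) (θ : D.Theta) : ℕ :=
  (D.typeSet θ (0 : D.MessageGroup k)).ncard

lemma ncard_typeSet (D : PrimaryDecomposition ι G) (k : D.pairs → ℕ) (θ : D.Theta)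
    (a : D.MessageGroup k) : (D.typeSet θ a).ncard = D.typeCard k θ := by
  have h : D.typeSet θ a = (fun x => x + a) '' D.typeSet θ (0 : D.MessageGroup k) := by
    ext x
    simp only [Set.mem_image, typeSet, Set.mem_ofPred_eq]
    constructor
    · intro hx
      exact ⟨x - a, by simpa using hx, by simp⟩
    · rintro ⟨y, hy, rfl⟩
      simpa using hy
  rw [h, Set.ncard_image_of_injective _ (add_left_injective a), typeCard]

/-- The exponent `min |r - s|⁺ + f_{p,r,m,s}` at the index `i = (p, r, m)`, the minimum being over
the `s` with `1 ≤ s ≤ r_p` and `k_{p,s} ≠ 0`. It is capped at `r`: this does not change the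
subgroup `p ^ exponent • ZMod (p ^ r)`, and makes it zero if there is no such `s`. -/
def minExponent (D : PrimaryDecomposition ι G) (k : D.pairs → ℕ)
    (f : (i : ι) → {σ : D.pairs // σ.1.1 = D.p i} → ℕ) (i : ι) : ℕ :=
  (Finset.univ.filter fun σ : {σ : D.pairs // σ.1.1 = D.p i} => k σ.1 ≠ 0).fold min (D.r i)
    fun σ => (D.r i - σ.1.1.2) + f i σ

/-- The subgroup of `G` that is the direct sum of the groups `p ^ t_i • ZMod (p ^ r)`. -/
def powSubgroup (D : PrimaryDecomposition ι G) (t : ι → ℕ) : AddSubgroup G :=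
  (AddSubgroup.pi Set.univ fun i =>
    AddSubgroup.zmultiples ((D.p i : ZMod (D.p i ^ D.r i)) ^ t i)).comap
      D.equiv.toAddMonoidHom

/-- The subgroup `H_η`. -/
def subgroupEta (D : PrimaryDecomposition ι G) (k : D.pairs → ℕ) (η : D.Eta) : AddSubgroup G :=
  D.powSubgroup (D.minExponent k fun i σ => η i σ)

/-- The subgroup `H_{η+θ̂}`. -/
def subgroupEtaTheta (D : PrimaryDecomposition ι G) (k : D.pairs → ℕ) (η : D.Eta)
    (θ : D.Theta) : AddSubgroup G :=
  D.powSubgroup (D.minExponent k fun i σ => (η i σ : ℕ) + (θ σ.1 : ℕ))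

end PrimaryDecomposition

/-- Density operators on the Hilbert space with orthonormal basis `N`. -/
def IsDensity {N : Type*} [Fintype N] (ρ : Matrix N N ℂ) : Prop :=
  ρ.PosSemidef ∧ ρ.trace = 1

/-- The smallest error of the second kind, `inf tr[Λσ]` over all `0 ≤ Λ ≤ I` with
`tr[Λρ] ≥ 1 - ε`. -/
def optimalTypeTwo {N : Type*} [Fintype N] [DecidableEq N] (ε : ℝ) (ρ σ : Matrix N N ℂ) : ℝ :=
  sInf {x : ℝ | ∃ Λ : Matrix N N ℂ, Λ.PosSemidef ∧ (1 - Λ).PosSemidef ∧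
    1 - ε ≤ (Λ * ρ).trace.re ∧ x = (Λ * σ).trace.re}

/-- The hypothesis testing relative entropy `D_H^ε(ρ‖σ) = -log₂ inf tr[Λσ]`, which is `⊤` if the
infimum is zero. -/
def hypothesisTestingEntropy {N : Type*} [Fintype N] [DecidableEq N] (ε : ℝ)
    (ρ σ : Matrix N N ℂ) : EReal :=
  if optimalTypeTwo ε ρ σ = 0 then ⊤ else ((-Real.logb 2 (optimalTypeTwo ε ρ σ) : ℝ) : EReal)

section States

variable {ι G N : Type*} [Fintype ι] [AddCommGroup G] [Fintype G] [DecidableEq G]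

open Classical in
/-- The state `∑_{x ∈ H + b} |H|⁻¹ |x⟩⟨x| ⊗ ρ_x`. -/
def cosetState (ρ : G → Matrix N N ℂ) (H : AddSubgroup G) (b : G) :
    Matrix (G × N) (G × N) ℂ :=
  ∑ x : G with x - b ∈ H, ((Nat.card H : ℂ)⁻¹) • (Matrix.single x x (1 : ℂ) ⊗ₖ ρ x)

open Classical in
/-- The state `∑_{x ∈ H + b} |H|⁻¹ ∑_{x' ∈ x + K} |K|⁻¹ |x'⟩⟨x'| ⊗ ρ_x`. -/
def conditionedState (ρ : G → Matrix N N ℂ) (H K : AddSubgroup G) (b : G) :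
    Matrix (G × N) (G × N) ℂ :=
  ∑ x : G with x - b ∈ H, ∑ x' : G with x' - x ∈ K,
    ((Nat.card H : ℂ)⁻¹ * (Nat.card K : ℂ)⁻¹) • (Matrix.single x' x' (1 : ℂ) ⊗ₖ ρ x)

/-- The joint state `π^{AB}_{η,b}` of channel input and output. -/
def jointState (D : PrimaryDecomposition ι G) (k : D.pairs → ℕ) (ρ : G → Matrix N N ℂ)
    (η : D.Eta) (b : G) : Matrix (G × N) (G × N) ℂ :=
  cosetState ρ (D.subgroupEta k η) b

/-- The state `π^{AB}_{η,b,J}`, the mixture over all `θ̂ ≠ (s)_{q,s}` of the states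
`π^{AB}_{η,b,θ̂}` with weights `|T_θ̂| / (|J| - 1)`. -/
def mixtureState (D : PrimaryDecomposition ι G) (k : D.pairs → ℕ) (ρ : G → Matrix N N ℂ)
    (η : D.Eta) (b : G) : Matrix (G × N) (G × N) ℂ :=
  (((Fintype.card (D.MessageGroup k) : ℂ) - 1)⁻¹) •
    ∑ θ : D.Theta with θ ≠ D.fullTheta, (D.typeCard k θ : ℂ) •
      conditionedState ρ (D.subgroupEta k η) (D.subgroupEtaTheta k η θ) b

end States

/-- A one-shot group transmission system over `G` with message group `J`: the encoder
`a ↦ φ(a) + v` given by a homomorphism and a shift, whose codebook is the shifted group code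
`{φ(a) + v | a ∈ J}`, and a decoding POVM indexed by the messages. -/
structure GroupTransmissionSystem (J G N : Type*) [AddCommGroup J] [Fintype J] [AddCommGroup G]
    [Fintype N] [DecidableEq N] where
  hom : J →+ G
  shift : G
  povm : J → Matrix N N ℂ
  povm_posSemidef : ∀ a, (povm a).PosSemidef
  povm_sum : ∑ a, povm a = 1

namespace GroupTransmissionSystem

variable {J G N : Type*} [AddCommGroup J] [Fintype J] [AddCommGroup G] [Fintype N] [DecidableEq N]

/-- The codeword of the message `a`. -/
def encode (S : GroupTransmissionSystem J G N) (a : J) : G := S.hom a + S.shift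

/-- The average probability of decoding error over the CQ channel `ρ`. -/
def errorProb (S : GroupTransmissionSystem J G N) (ρ : G → Matrix N N ℂ) : ℝ :=
  ∑ a : J, (1 / (Fintype.card J : ℝ)) * (1 - (S.povm a * ρ (S.encode a)).trace.re)

/-- `S` has parameters `(1, Ω, τ)` over `ρ`: it is used once, has `Ω` messages, and its average
error probability is at most `τ`. -/
def HasParameters (S : GroupTransmissionSystem J G N) (ρ : G → Matrix N N ℂ) (Ω : ℕ) (τ : ℝ) :
    Prop :=
  Fintype.card J = Ω ∧ S.errorProb ρ ≤ τ

end GroupTransmissionSystem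

/-- The bound `max_{η,b} D_H^ε(π^{AB}_{η,b} ‖ π^{AB}_{η,b,J}) - log₂ (4ε' / (ε' - ε)²)`. Only
finitely many pairs `(η, b)` exist, so the supremum is a maximum. -/
def rateBound {ι G N : Type*} [Fintype ι] [AddCommGroup G] [Fintype G] [DecidableEq G]
    [Fintype N] [DecidableEq N] (D : PrimaryDecomposition ι G) (k : D.pairs → ℕ)
    (ρ : G → Matrix N N ℂ) (ε ε' : ℝ) : EReal :=
  (⨆ (η : D.Eta) (b : G),
      hypothesisTestingEntropy ε (jointState D k ρ η b) (mixtureState D k ρ η b)) -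
    ((Real.logb 2 (4 * ε' / (ε' - ε) ^ 2) : ℝ) : EReal)

end

/-!
The second assertion is proved by random coding. Fix `η` and `b`, and let the component with index
`i = (p, r, m)` of the homomorphism `φ` be `a ↦ ∑_{s,j} p ^ (|r - s|⁺ + η_s) a_{s,j} g_{s,j}` with
independent uniform coefficients `g_{s,j}` in `ZMod (p ^ r)`, and let the shift `v` be uniform on
`H_η + b`. For a fixed message `a` the map `g ↦ φ(a)` is a homomorphism whose range is `H_{η+θ̂}`,
where `θ̂` is the type of `a` (`PrimaryDecomposition.range_codewordHom`). So each codeword is uniform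
on `H_η + b`, and given the codeword `x` of `a`, that of `a'` is uniform on `x + H_{η+θ̂}`, where
`θ̂` is the type of `a' - a`. Averaged over the codes, the probability that a test `Λ` misses the
codeword sent is therefore the error of the first kind of `Λ` on `π_{η,b}`, and the probabilities
that it accepts another codeword add up to `|J| - 1` times the error of the second kind on
`π_{η,b,J}` (`PrimaryDecomposition.exists_code_sum_le`).

The decoder is the square-root measurement of the tests for the single codewords. By the inequality
of Hayashi and Nagaoka (`hayashi_nagaoka`) its error is at most
`(1 + c) ε + (2 + c + 1 / c) (|J| - 1) β`, with `ε` and `β` the errors of the two kinds, and for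
`c = (ε' - ε) / (ε' + ε)` this is at most `ε'` as soon as `(|J| - 1) β ≤ (ε' - ε)² / (4 ε')`. The
assumption bounds `|J| β` instead, for the infimum `β`; the difference leaves room both for a test
that attains the infimum only approximately and for a small multiple of the identity that makes the
sum of the tests invertible.

For the first assertion let `ε'` be the least error probability of all systems, which exists because
there are finitely many encoders and the POVMs form a compact set. For `t < ε'` no system has error
at most `t`, so the second assertion forces the rate to exceed the bound with `t` in place of `ε'`,
and the bound is continuous in `t`.
-/

open scoped Kronecker ComplexOrder

noncomputable section

/-! ### The operator inequality of Hayashi and Nagaoka -/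

section OperatorInequality

open scoped MatrixOrder Matrix.Norms.L2Operator

variable {N : Type*} [Fintype N] [DecidableEq N]

lemma trace_mul_re_nonneg {A B : Matrix N N ℂ} (hA : A.PosSemidef) (hB : B.PosSemidef) :
    0 ≤ (A * B).trace.re := by
  have hA0 : 0 ≤ A := Matrix.nonneg_iff_posSemidef.2 hA
  have hR : (CFC.sqrt A).IsHermitian :=
    (Matrix.nonneg_iff_posSemidef.1 (CFC.sqrt_nonneg A)).isHermitian
  have h : (A * B).trace = (CFC.sqrt A * B * (CFC.sqrt A).conjTranspose).trace := by
    rw [hR.eq, Matrix.trace_mul_comm (CFC.sqrt A * B), ← mul_assoc, CFC.sqrt_mul_sqrt_self A]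
  rw [h]
  exact (Complex.le_def.1 (hB.mul_mul_conjTranspose_same _).trace_nonneg).1

lemma trace_mul_re_le {A B ρ : Matrix N N ℂ} (h : (B - A).PosSemidef) (hρ : ρ.PosSemidef) :
    (A * ρ).trace.re ≤ (B * ρ).trace.re := by
  have := trace_mul_re_nonneg h hρ
  rw [sub_mul, Matrix.trace_sub, Complex.sub_re] at this
  linarith

/-- The square root of `S + T` dominates `S` because `S ^ 2 ≤ S ≤ S + T` and the square root is
operator monotone. -/
lemma le_sqrt_add {S T : Matrix N N ℂ} (hS : 0 ≤ S) (hS1 : S ≤ 1) (hT : 0 ≤ T) :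
    S ≤ CFC.sqrt (S + T) := by
  have hR : IsSelfAdjoint (CFC.sqrt S) := (CFC.sqrt_nonneg S).isSelfAdjoint
  have h1 : S * S ≤ S := by
    have h := hR.conjugate_le_conjugate hS1
    have hc : CFC.sqrt S * S * CFC.sqrt S = S * S := by
      conv_rhs => rw [← CFC.sqrt_mul_sqrt_self S]
      nth_rw 2 [← CFC.sqrt_mul_sqrt_self S]
      noncomm_ring
    rwa [hc, mul_one, CFC.sqrt_mul_sqrt_self S] at h
  calc S = CFC.sqrt (S * S) := (CFC.sqrt_mul_self S).symm
    _ ≤ CFC.sqrt (S + T) := CFC.sqrt_le_sqrt _ _ (h1.trans (le_add_of_nonneg_right hT))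

/-- The operator inequality of Hayashi and Nagaoka, for an invertible `S + T`; here
`K = (S + T)^{-1/2}`, so that `1 - K S K = K T K`. -/
lemma hayashi_nagaoka {S T K : Matrix N N ℂ} {c : ℝ} (hc : 0 < c) (hS : 0 ≤ S) (hS1 : S ≤ 1)
    (hT : 0 ≤ T) (hK : K * CFC.sqrt (S + T) = 1) (hK' : CFC.sqrt (S + T) * K = 1)
    (hKsa : IsSelfAdjoint K) :
    1 - K * S * K ≤ (1 + c) • (1 - S) + (2 + c + c⁻¹) • T := by
  set M := CFC.sqrt (S + T) with hM
  have hMM : M * M = S + T := CFC.sqrt_mul_sqrt_self _ (add_nonneg hS hT)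
  have hSM : S ≤ M := le_sqrt_add hS hS1 hT
  have hmono : ∀ (t : ℝ) (X : Matrix N N ℂ), 0 ≤ t → 0 ≤ X → 0 ≤ t • X := fun t X ht hX =>
    Matrix.nonneg_iff_posSemidef.2 ((Matrix.nonneg_iff_posSemidef.1 hX).smul ht)
  -- the difference of the two sides is the sum of the following three terms
  have e1 : 0 ≤ c⁻¹ • ((c • (K - 1) - 1) * T * (c • (K - 1) - 1)) := by
    refine hmono _ _ (by positivity) (IsSelfAdjoint.conjugate_nonneg hT ?_)
    exact (((IsSelfAdjoint.all c).smul (hKsa.sub (.one _))).sub (.one _))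
  have e2 : 0 ≤ (1 + c) • ((K - 1) * S * (K - 1)) :=
    hmono _ _ (by positivity) (IsSelfAdjoint.conjugate_nonneg hS (hKsa.sub (.one _)))
  have e3 : 0 ≤ (2 * (1 + c)) • (M - S) := hmono _ _ (by positivity) (sub_nonneg.2 hSM)
  have hST : (K - 1) * S * (K - 1) + (K - 1) * T * (K - 1) = 1 - (2 : ℝ) • M + S + T := by
    calc _ = (K - 1) * (S + T) * (K - 1) := by noncomm_ring
      _ = (K * M - M) * (M * K - M) := by rw [← hMM]; noncomm_ring
      _ = 1 - M - M + M * M := by rw [hK, hK']; noncomm_ring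
      _ = _ := by rw [hMM, two_smul]; abel
  have hKK : 1 - K * S * K = K * T * K := by
    have : K * (S + T) * K = 1 := by
      calc K * (S + T) * K = (K * M) * (M * K) := by rw [← hMM]; noncomm_ring
        _ = 1 := by rw [hK, hK', one_mul]
    rw [← this]; noncomm_ring
  have key : (1 + c) • (1 - S) + (2 + c + c⁻¹) • T - K * T * K =
      c⁻¹ • ((c • (K - 1) - 1) * T * (c • (K - 1) - 1)) + (1 + c) • ((K - 1) * S * (K - 1)) +
        (2 * (1 + c)) • (M - S) := by
    have h2 : (K - 1) * S * (K - 1) = 1 - (2 : ℝ) • M + S + T - (K - 1) * T * (K - 1) :=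
      eq_sub_of_add_eq hST
    have h3 : c⁻¹ • ((c • (K - 1) - 1) * T * (c • (K - 1) - 1)) =
        c • ((K - 1) * T * (K - 1)) - (K - 1) * T - T * (K - 1) + c⁻¹ • T := by
      have : (c • (K - 1) - 1) * T * (c • (K - 1) - 1) =
        c • c • ((K - 1) * T * (K - 1)) - c • ((K - 1) * T) - c • (T * (K - 1)) + T := by
        simp only [sub_mul, mul_sub, smul_mul_assoc, mul_smul_comm, one_mul, mul_one, smul_sub]
        abel
      rw [this]
      simp only [smul_add, smul_sub, smul_smul, inv_mul_cancel₀ hc.ne', ← mul_assoc, one_smul,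
        one_mul]
    have h4 : (K - 1) * T * (K - 1) = K * T * K - K * T - T * K + T := by noncomm_ring
    rw [h2, h3, h4, sub_mul, mul_sub, one_mul, mul_one]
    module
  rw [hKK, ← sub_nonneg, key]
  exact add_nonneg (add_nonneg e1 e2) e3

end OperatorInequality

/-! ### The square-root measurement -/

section Decoder

open scoped MatrixOrder Matrix.Norms.L2Operator

variable {N : Type*} [Fintype N] [DecidableEq N]

/-- The square-root measurement for the tests `A a`. The multiple `δ` of the identity makes the
sum of the tests invertible, at the price of `δ` in the bound. -/
lemma exists_povm_one_sub_trace_le {J : Type*} [Fintype J] [Nonempty J] [DecidableEq J]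
    {A : J → Matrix N N ℂ} (hA : ∀ a, (A a).PosSemidef) (hA1 : ∀ a, (1 - A a).PosSemidef)
    {c δ : ℝ} (hc : 0 < c) (hδ : 0 < δ) :
    ∃ P : J → Matrix N N ℂ, (∀ a, (P a).PosSemidef) ∧ ∑ a, P a = 1 ∧
      ∀ a (ρ : Matrix N N ℂ), IsDensity ρ → 1 - (P a * ρ).trace.re ≤
        (1 + c) * (1 - (A a * ρ).trace.re) +
          (2 + c + c⁻¹) * (∑ b with b ≠ a, (A b * ρ).trace.re + δ) := by
  have hone : ∀ t : ℝ, 0 ≤ t → (t • (1 : Matrix N N ℂ)).PosSemidef := fun t ht =>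
    Matrix.PosSemidef.one.smul ht
  set W : Matrix N N ℂ := ∑ a, A a + δ • 1 with hW
  have hWpd : W.PosDef := by
    refine Matrix.PosDef.posSemidef_add ?_ (Matrix.PosDef.one.smul hδ)
    exact Matrix.posSemidef_sum _ fun a _ => hA a
  have hW0 : 0 ≤ W := Matrix.nonneg_iff_posSemidef.2 hWpd.posSemidef
  set M := CFC.sqrt W with hM
  have hMM : M * M = W := CFC.sqrt_mul_sqrt_self W
  have hMsa : M.IsHermitian := (Matrix.nonneg_iff_posSemidef.1 (CFC.sqrt_nonneg W)).isHermitian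
  have hMu : IsUnit M.det := by
    have h := (Matrix.isUnit_iff_isUnit_det _).1 hWpd.isUnit
    rw [← hMM, Matrix.det_mul] at h
    exact isUnit_of_mul_isUnit_left h
  have hKM : M⁻¹ * M = 1 := Matrix.nonsing_inv_mul _ hMu
  have hMK : M * M⁻¹ = 1 := Matrix.mul_nonsing_inv _ hMu
  have hK : (M⁻¹).IsHermitian := hMsa.inv
  set K := M⁻¹ with hKdef
  have hconj : ∀ X : Matrix N N ℂ, X.PosSemidef → (K * X * K).PosSemidef := fun X hX => by
    have := hX.mul_mul_conjTranspose_same K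
    rwa [hK.eq] at this
  have hcard : (Fintype.card J : ℝ) ≠ 0 := Nat.cast_ne_zero.2 Fintype.card_ne_zero
  refine ⟨fun a => K * (A a + (δ / Fintype.card J) • 1) * K, fun a => ?_, ?_, fun a ρ hρ => ?_⟩
  · exact hconj _ ((hA a).add (hone _ (by positivity)))
  · rw [← Finset.sum_mul, ← Finset.mul_sum, Finset.sum_add_distrib, Finset.sum_const,
      Finset.card_univ, ← Nat.cast_smul_eq_nsmul ℝ, smul_smul, mul_div_cancel₀ _ hcard, ← hW,
      ← hMM]
    calc K * (M * M) * K = (K * M) * (M * K) := by noncomm_ring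
      _ = 1 := by rw [hKM, hMK, one_mul]
  · set T : Matrix N N ℂ := ∑ b with b ≠ a, A b + δ • 1 with hT
    have hST : A a + T = W := by
      rw [hT, hW, ← add_assoc, ← Finset.sum_filter_add_sum_filter_not Finset.univ (· = a)]
      simp [Finset.filter_eq']
    have hT0 : 0 ≤ T := Matrix.nonneg_iff_posSemidef.2
      ((Matrix.posSemidef_sum _ fun b _ => hA b).add (hone _ hδ.le))
    have h := hayashi_nagaoka (S := A a) (T := T) (K := K) hc
      (Matrix.nonneg_iff_posSemidef.2 (hA a)) (Matrix.le_iff.2 (hA1 a)) hT0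
      (by rw [hST]; exact hKM) (by rw [hST]; exact hMK) hK
    have hP : 1 - K * (A a + (δ / Fintype.card J) • 1) * K ≤ 1 - K * A a * K := by
      refine Matrix.le_iff.2 ?_
      have := hconj _ (hone (δ / Fintype.card J) (by positivity))
      have e : 1 - K * A a * K - (1 - K * (A a + (δ / Fintype.card J) • 1) * K) =
          K * ((δ / Fintype.card J) • 1) * K := by rw [mul_add, add_mul]; abel
      rwa [e]
    have h1 := trace_mul_re_le (Matrix.le_iff.1 (hP.trans h)) hρ.1
    have hTr : ∀ (t : ℝ) (X : Matrix N N ℂ), (t • X * ρ).trace.re = t * (X * ρ).trace.re := by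
      intro t X
      rw [smul_mul_assoc, Matrix.trace_smul, Complex.smul_re, smul_eq_mul]
    have hρ1 : (1 * ρ).trace.re = 1 := by rw [one_mul, hρ.2, Complex.one_re]
    have hTT : (T * ρ).trace.re = ∑ b with b ≠ a, (A b * ρ).trace.re + δ := by
      rw [hT, add_mul, Matrix.trace_add, Complex.add_re, hTr, hρ1, mul_one, Finset.sum_mul,
        Matrix.trace_sum, Complex.re_sum]
    rwa [add_mul ((1 + c) • (1 - A a)), Matrix.trace_add, Complex.add_re, hTr, hTr, hTT, sub_mul,
      sub_mul, Matrix.trace_sub, Matrix.trace_sub, Complex.sub_re, Complex.sub_re, hρ1] at h1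

end Decoder

/-! ### Systems of least error -/

section OptimalSystem

open scoped MatrixOrder Matrix.Norms.L2Operator

lemma isCompact_povms (J N : Type*) [Fintype J] [Fintype N] [DecidableEq N] :
    IsCompact {P : J → Matrix N N ℂ | (∀ a, (P a).PosSemidef) ∧ ∑ a, P a = 1} := by
  refine Metric.isCompact_of_isClosed_isBounded ?_ ?_
  · simp only [← Matrix.nonneg_iff_posSemidef, Set.ofPred_and, Set.ofPred_forall]
    refine IsClosed.inter (isClosed_iInter fun a => ?_) ?_
    · exact isClosed_le continuous_const (continuous_apply a)
    · exact isClosed_eq (by fun_prop) continuous_const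
  · refine isBounded_iff_forall_norm_le.2 ⟨1, fun P hP => ?_⟩
    refine (pi_norm_le_iff_of_nonneg zero_le_one).2 fun a => ?_
    have hnn : ∀ b, 0 ≤ P b := fun b => Matrix.nonneg_iff_posSemidef.2 (hP.1 b)
    refine (CStarAlgebra.norm_le_one_iff_of_nonneg (P a) (hnn a)).2 ?_
    rw [← hP.2]
    exact Finset.single_le_sum (fun b _ => hnn b) (Finset.mem_univ a)

variable {J G N : Type*} [AddCommGroup J] [Fintype J] [AddCommGroup G] [Fintype N] [DecidableEq N]

namespace GroupTransmissionSystem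

/-- Some system has the least error probability: there are finitely many encoders, and for each
of them the error is a continuous function on the compact set of POVMs. -/
lemma exists_forall_errorProb_le [Finite G] (ρ : G → Matrix N N ℂ) :
    ∃ S : GroupTransmissionSystem J G N, ∀ S' : GroupTransmissionSystem J G N,
      S.errorProb ρ ≤ S'.errorProb ρ := by
  classical
  have hmin : ∀ e : (J →+ G) × G, ∃ S : GroupTransmissionSystem J G N,
      ∀ S' : GroupTransmissionSystem J G N, (S'.hom, S'.shift) = e →
        S.errorProb ρ ≤ S'.errorProb ρ := by
    rintro ⟨φ, v⟩
    have hne : {P : J → Matrix N N ℂ | (∀ a, (P a).PosSemidef) ∧ ∑ a, P a = 1}.Nonempty := by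
      refine ⟨Pi.single 0 1, fun a => ?_, by simp⟩
      by_cases h : a = 0
      · subst h; simpa using Matrix.PosSemidef.one
      · simpa [h] using Matrix.PosSemidef.zero
    obtain ⟨P, hP, hmin⟩ := (isCompact_povms J N).exists_isMinOn hne
      (f := fun P => ∑ a : J, (1 / (Fintype.card J : ℝ)) *
        (1 - (P a * ρ (φ a + v)).trace.re)) (by
        refine Continuous.continuousOn (continuous_finsetSum _ fun a _ => ?_)
        refine continuous_const.mul (continuous_const.sub ?_)
        refine Complex.continuous_re.comp (Continuous.matrix_trace ?_)
        exact (continuous_apply a).matrix_mul continuous_const)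
    refine ⟨⟨φ, v, P, hP.1, hP.2⟩, fun S' hS' => ?_⟩
    obtain ⟨φ', v', P', h1, h2⟩ := S'
    obtain ⟨rfl, rfl⟩ := Prod.mk.inj hS'
    exact hmin ⟨h1, h2⟩
  have : Finite (J →+ G) := DFunLike.finite _
  choose F hF using hmin
  obtain ⟨e, he⟩ := Finite.exists_min fun e => (F e).errorProb ρ
  exact ⟨F e, fun S' => (he _).trans (hF (S'.hom, S'.shift) S' rfl)⟩

lemma errorProb_mem_Icc (S : GroupTransmissionSystem J G N) {ρ : G → Matrix N N ℂ}
    (hρ : ∀ x, IsDensity (ρ x)) : S.errorProb ρ ∈ Set.Icc (0 : ℝ) 1 := by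
  have hJ : (0 : ℝ) < Fintype.card J := Nat.cast_pos.2 Fintype.card_pos
  have hle : ∀ a x, (S.povm a * ρ x).trace.re ≤ 1 := fun a x => by
    have h1 : S.povm a ≤ 1 := by
      rw [← S.povm_sum]
      exact Finset.single_le_sum
        (fun b _ => Matrix.nonneg_iff_posSemidef.2 (S.povm_posSemidef b)) (Finset.mem_univ a)
    have := trace_mul_re_le (Matrix.le_iff.1 h1) (hρ x).1
    rwa [one_mul, (hρ x).2, Complex.one_re] at this
  rw [errorProb, ← Finset.mul_sum]
  constructor
  · exact mul_nonneg (by positivity) (Finset.sum_nonneg fun a _ => sub_nonneg.2 (hle _ _))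
  · rw [one_div, inv_mul_le_iff₀ hJ, mul_one]
    calc _ ≤ ∑ _a : J, (1 : ℝ) := Finset.sum_le_sum fun a _ => by
          linarith [trace_mul_re_nonneg (S.povm_posSemidef a) (hρ (S.encode a)).1]
      _ = _ := by simp

end GroupTransmissionSystem

end OptimalSystem

/-- The bound depends on `ε'` through a continuous real term only, so an upper bound for all
values just below `ε'` persists at `ε'`. -/
lemma rateBound_le_of_forall_lt {ι G N : Type*} [Fintype ι] [AddCommGroup G] [Fintype G]
    [DecidableEq G] [Fintype N] [DecidableEq N] {D : PrimaryDecomposition ι G} {k : D.pairs → ℕ}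
    {ρ : G → Matrix N N ℂ} {ε ε' R : ℝ} (hε : 0 < ε) (hε' : ε < ε')
    (h : ∀ t ∈ Set.Ioo ε ε', rateBound D k ρ ε t ≤ (R : EReal)) :
    rateBound D k ρ ε ε' ≤ (R : EReal) := by
  unfold rateBound at h ⊢
  generalize (⨆ (η : D.Eta) (b : G),
    hypothesisTestingEntropy ε (jointState D k ρ η b) (mixtureState D k ρ η b)) = X at h ⊢
  induction X with
  | bot => simp
  | top =>
    obtain ⟨t, ht⟩ := Set.nonempty_Ioo.2 hε'
    have := h t ht
    rw [EReal.top_sub_coe] at this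
    exact absurd this (by simp)
  | coe x =>
    norm_cast at h ⊢
    have hpos : 0 < 4 * ε' / (ε' - ε) ^ 2 :=
      div_pos (by linarith) (pow_pos (sub_pos.2 hε') 2)
    have hq : ContinuousAt (fun t : ℝ => 4 * t / (t - ε) ^ 2) ε' :=
      ContinuousAt.div (by fun_prop) (by fun_prop) (pow_pos (sub_pos.2 hε') 2).ne'
    have hc : ContinuousAt (fun t => x - Real.logb 2 (4 * t / (t - ε) ^ 2)) ε' :=
      continuousAt_const.sub ((hq.log hpos.ne').div_const _)
    refine le_of_tendsto (hc.tendsto.mono_left (nhdsWithin_le_nhds (s := Set.Iio ε'))) ?_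
    filter_upwards [Ioo_mem_nhdsLT hε'] with t ht using h t ht

/-! ### Arithmetic of `ZMod (q ^ s)` and types of messages -/

section Arithmetic

lemma ZMod.mem_zmultiples_iff_dvd {n : ℕ} (d x : ZMod n) :
    x ∈ AddSubgroup.zmultiples d ↔ d ∣ x := by
  rw [AddSubgroup.mem_zmultiples_iff]
  constructor
  · rintro ⟨z, rfl⟩
    exact ⟨z, by rw [zsmul_eq_mul, mul_comm]⟩
  · rintro ⟨w, rfl⟩
    exact ⟨w.cast, by rw [zsmul_eq_mul, ZMod.intCast_zmod_cast, mul_comm]⟩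

lemma ZMod.pow_dvd_val_iff {q s t : ℕ} [NeZero (q ^ s)] (ht : t ≤ s) (x : ZMod (q ^ s)) :
    q ^ t ∣ x.val ↔ ∃ w : ZMod (q ^ s), x = (q ^ t) • w := by
  constructor
  · rintro ⟨m, hm⟩
    refine ⟨m, ?_⟩
    rw [← ZMod.natCast_zmod_val x, hm, nsmul_eq_mul, Nat.cast_mul]
  · rintro ⟨w, rfl⟩
    have h : (q ^ t) • w = ((q ^ t * w.val : ℕ) : ZMod (q ^ s)) := by
      rw [nsmul_eq_mul, Nat.cast_mul, ZMod.natCast_zmod_val w]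
    rw [h, ZMod.val_natCast, Nat.dvd_mod_iff (pow_dvd_pow q ht)]
    exact dvd_mul_right _ _

/-- The homomorphism `a ↦ a * d` from `ZMod m` to `ZMod n`, for `d` annihilated by `m`. -/
def ZMod.mulHom {m n : ℕ} (d : ZMod n) (h : (m : ZMod n) * d = 0) : ZMod m →+ ZMod n :=
  ZMod.lift m ⟨(AddMonoidHom.mulRight d).comp (Int.castAddHom (ZMod n)), by simpa using h⟩

lemma ZMod.mulHom_apply {m n : ℕ} [NeZero m] (d : ZMod n) (h : (m : ZMod n) * d = 0)
    (a : ZMod m) : ZMod.mulHom d h a = a.val * d := by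
  conv_lhs => rw [← ZMod.natCast_zmod_val a, ← Int.cast_natCast (R := ZMod m)]
  rw [ZMod.mulHom, ZMod.lift_coe]
  simp

/-- If `p ^ t` divides all coefficients `c` and, unless it is zero in `ZMod (p ^ r)`, is the exact
power of `p` in one of them, then the coefficients generate the ideal `p ^ t • ZMod (p ^ r)`: up to
a unit, the one with the exact power equals `p ^ t`. -/
lemma ZMod.exists_sum_mul_eq_iff {p r t : ℕ} (hp : p.Prime) {A : Type*} [Fintype A] {n : A → ℕ}
    {c : (σ : A) → Fin (n σ) → ℕ} (h1 : ∀ σ j, p ^ t ∣ c σ j)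
    (h2 : t < r → ∃ σ j m, c σ j = p ^ t * m ∧ ¬ p ∣ m) (y : ZMod (p ^ r)) :
    (∃ g : (σ : A) → Fin (n σ) → ZMod (p ^ r), ∑ σ, ∑ j, c σ j * g σ j = y) ↔
      (p : ZMod (p ^ r)) ^ t ∣ y := by
  classical
  constructor
  · rintro ⟨g, rfl⟩
    refine Finset.dvd_sum fun σ _ => Finset.dvd_sum fun j _ => Dvd.dvd.mul_right ?_ _
    exact_mod_cast Nat.cast_dvd_cast (α := ZMod (p ^ r)) (h1 σ j)
  · rintro ⟨w, rfl⟩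
    by_cases ht : t < r
    · obtain ⟨σ, j, m, hm, hpm⟩ := h2 ht
      have hu : (m : ZMod (p ^ r)) * (m : ZMod (p ^ r))⁻¹ = 1 :=
        ZMod.coe_mul_inv_eq_one m
          (((Nat.coprime_comm.1 ((Nat.Prime.coprime_iff_not_dvd hp).2 hpm))).pow_right r)
      refine ⟨Pi.single σ (Pi.single j ((m : ZMod (p ^ r))⁻¹ * w)), ?_⟩
      rw [Finset.sum_eq_single σ (fun τ _ hτ => by simp [Pi.single_eq_of_ne hτ]) (by simp),
        Pi.single_eq_same, Finset.sum_eq_single j (fun l _ hl => by simp [Pi.single_eq_of_ne hl])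
          (by simp), Pi.single_eq_same, hm]
      push_cast
      rw [mul_assoc, ← mul_assoc (m : ZMod (p ^ r)), hu, one_mul]
    · refine ⟨0, ?_⟩
      have h0 : (p : ZMod (p ^ r)) ^ t = 0 := by
        rw [← Nat.cast_pow, ZMod.natCast_eq_zero_iff]
        exact pow_dvd_pow p (not_lt.1 ht)
      simp [h0]

end Arithmetic

namespace PrimaryDecomposition

section Layers

/-- A vector lies in the layer `t < s` if `q ^ t` is the largest power of `q` that divides the
representatives of all its coordinates, and in the layer `s` if it is zero. -/
lemma mem_layer_iff {q s n t : ℕ} [NeZero (q ^ s)] (ht : t ≤ s) (v : Fin n → ZMod (q ^ s)) :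
    v ∈ layer q s n t ↔
      (∀ j, q ^ t ∣ (v j).val) ∧ (t < s → ∃ j, ¬ q ^ (t + 1) ∣ (v j).val) := by
  have key : ∀ t ≤ s, (∃ w : Fin n → ZMod (q ^ s), v = (q ^ t) • w) ↔
      ∀ j, q ^ t ∣ (v j).val := by
    intro t ht
    simp only [ZMod.pow_dvd_val_iff ht, Classical.skolem, funext_iff, Pi.smul_apply]
  rcases ht.eq_or_lt with rfl | hlt
  · simp only [layer, if_true, Set.mem_singleton_iff, lt_irrefl, false_imp_iff, and_true,
      funext_iff, Pi.zero_apply]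
    refine forall_congr' fun j => ?_
    rw [← ZMod.val_eq_zero]
    exact ⟨fun h => h ▸ dvd_zero _, fun h => Nat.eq_zero_of_dvd_of_lt h (ZMod.val_lt _)⟩
  · simp only [layer, hlt.ne, if_false, Set.mem_ofPred_eq, hlt, true_imp_iff]
    rw [key t ht, key (t + 1) hlt, not_forall]

lemma existsUnique_mem_layer {q s n : ℕ} [NeZero (q ^ s)] (v : Fin n → ZMod (q ^ s)) :
    ∃! t : Fin (s + 1), v ∈ layer q s n t := by
  classical
  set P : ℕ → Prop := fun t => ∀ j, q ^ t ∣ (v j).val with hP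
  have hex : P (Nat.findGreatest P s) :=
    Nat.findGreatest_spec (Nat.zero_le s) (fun j => by simp)
  refine ⟨⟨Nat.findGreatest P s, Nat.lt_succ_of_le (Nat.findGreatest_le s)⟩,
    (mem_layer_iff (Nat.findGreatest_le s) v).2 ⟨hex, fun hlt => ?_⟩, fun t ht => ?_⟩
  · have := Nat.findGreatest_is_greatest (P := P) (Nat.lt_succ_self _) hlt
    simpa [hP] using this
  · have hts : (t : ℕ) ≤ s := Nat.lt_succ_iff.1 t.2
    obtain ⟨h1, h2⟩ := (mem_layer_iff hts v).1 ht
    refine Fin.ext (le_antisymm (Nat.le_findGreatest hts h1) (not_lt.1 fun hlt => ?_))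
    obtain ⟨j, hj⟩ := h2 (lt_of_lt_of_le hlt (Nat.findGreatest_le s))
    exact hj ((pow_dvd_pow q hlt).trans (hex j))

end Layers

variable {ι G : Type*} [Fintype ι] [AddCommGroup G]

lemma existsUnique_mem_typeSet (D : PrimaryDecomposition ι G) {k : D.pairs → ℕ}
    (a : D.MessageGroup k) : ∃! θ : D.Theta, a ∈ D.typeSet θ (0 : D.MessageGroup k) := by
  choose θ hθ hu using fun σ : D.pairs => existsUnique_mem_layer (a σ)
  refine ⟨θ, fun σ => by simpa using hθ σ, fun θ' h => funext fun σ => hu σ _ ?_⟩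
  simpa using h σ

/-- The type of a message `a`: the unique `θ̂` with `a ∈ T_θ̂(0)`. -/
def typeOf (D : PrimaryDecomposition ι G) {k : D.pairs → ℕ} (a : D.MessageGroup k) : D.Theta :=
  (D.existsUnique_mem_typeSet a).choose

lemma mem_typeSet_zero_iff (D : PrimaryDecomposition ι G) {k : D.pairs → ℕ}
    (a : D.MessageGroup k) (θ : D.Theta) :
    a ∈ D.typeSet θ (0 : D.MessageGroup k) ↔ D.typeOf a = θ :=
  ⟨fun h => ((D.existsUnique_mem_typeSet a).choose_spec.2 θ h).symm,
    fun h => h ▸ (D.existsUnique_mem_typeSet a).choose_spec.1⟩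

lemma typeOf_eq_fullTheta_iff (D : PrimaryDecomposition ι G) {k : D.pairs → ℕ}
    (a : D.MessageGroup k) : D.typeOf a = D.fullTheta ↔ a = 0 := by
  rw [← mem_typeSet_zero_iff]
  simp [typeSet, fullTheta, layer, funext_iff]

/-- Summation over the nonzero messages, grouped by type. -/
lemma sum_ne_zero_eq_sum_typeCard (D : PrimaryDecomposition ι G) (k : D.pairs → ℕ)
    (F : D.Theta → ℝ) :
    ∑ a : D.MessageGroup k with a ≠ 0, F (D.typeOf a) =
      ∑ θ : D.Theta with θ ≠ D.fullTheta, (D.typeCard k θ : ℝ) * F θ := by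
  classical
  rw [← Finset.sum_fiberwise_of_maps_to (s := {a : D.MessageGroup k | a ≠ 0})
    (t := {θ : D.Theta | θ ≠ D.fullTheta}) (g := D.typeOf) (fun a ha => by
      simpa [typeOf_eq_fullTheta_iff] using ha)]
  refine Finset.sum_congr rfl fun θ hθ => ?_
  have hcard : D.typeCard k θ = (Finset.filter (fun a : D.MessageGroup k => D.typeOf a = θ)
      {a : D.MessageGroup k | a ≠ 0}).card := by
    rw [typeCard, ← Set.ncard_coe_finset]
    congr 1
    ext a
    simp only [mem_typeSet_zero_iff, Finset.coe_filter, Finset.mem_filter, Finset.mem_univ,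
      true_and, Set.mem_ofPred_eq]
    refine ⟨fun h => ⟨fun h0 => ?_, h⟩, fun h => h.2⟩
    exact (Finset.mem_filter.1 hθ).2 (h ▸ (D.typeOf_eq_fullTheta_iff a).2 h0)
  rw [hcard, ← nsmul_eq_mul, ← Finset.sum_const]
  exact Finset.sum_congr rfl fun a ha => by rw [(Finset.mem_filter.1 ha).2]

end PrimaryDecomposition

/-! ### Homomorphisms with random coefficients -/

namespace PrimaryDecomposition

variable {ι G : Type*} [Fintype ι] [AddCommGroup G]

lemma one_lt_card_messageGroup (D : PrimaryDecomposition ι G)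
    {k : D.pairs → ℕ} (hk : ∃ σ, k σ ≠ 0) : 1 < Fintype.card (D.MessageGroup k) := by
  obtain ⟨σ, hσ⟩ := hk
  have hs : σ.1.2 ≠ 0 := by
    obtain ⟨i, -, h⟩ := Finset.mem_biUnion.1 σ.2
    obtain ⟨t, ht, h⟩ := Finset.mem_image.1 h
    rw [← h]
    exact Nat.one_le_iff_ne_zero.1 (Finset.mem_Icc.1 ht).1
  have : Fact (1 < σ.1.1 ^ σ.1.2) := ⟨Nat.one_lt_pow hs (D.prime_of_mem_pairs σ).one_lt⟩
  have : Nonempty (Fin (k σ)) := ⟨⟨0, Nat.pos_of_ne_zero hσ⟩⟩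
  have : Nontrivial (D.MessageGroup k) := Pi.nontrivial_at σ
  exact Fintype.one_lt_card

lemma minExponent_le (D : PrimaryDecomposition ι G) (k : D.pairs → ℕ)
    (f : (i : ι) → {σ : D.pairs // σ.1.1 = D.p i} → ℕ) (i : ι)
    (σ : {σ : D.pairs // σ.1.1 = D.p i}) (hσ : k σ.1 ≠ 0) :
    D.minExponent k f i ≤ (D.r i - σ.1.1.2) + f i σ :=
  (Finset.fold_min_le _).2 (Or.inr ⟨σ, by simpa using hσ, le_rfl⟩)

lemma exists_eq_minExponent (D : PrimaryDecomposition ι G) (k : D.pairs → ℕ)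
    (f : (i : ι) → {σ : D.pairs // σ.1.1 = D.p i} → ℕ) (i : ι)
    (h : D.minExponent k f i < D.r i) :
    ∃ σ : {σ : D.pairs // σ.1.1 = D.p i}, k σ.1 ≠ 0 ∧
      D.minExponent k f i = (D.r i - σ.1.1.2) + f i σ := by
  rcases (Finset.fold_min_le _).1 (le_refl (D.minExponent k f i)) with h' | ⟨σ, hσ, h'⟩
  · exact absurd h' (not_le.2 h)
  · have hσ' : k σ.1 ≠ 0 := by simpa using hσ
    exact ⟨σ, hσ', le_antisymm (D.minExponent_le k f i σ hσ') h'⟩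

lemma minExponent_mono (D : PrimaryDecomposition ι G) (k : D.pairs → ℕ)
    {f f' : (i : ι) → {σ : D.pairs // σ.1.1 = D.p i} → ℕ} (hf : ∀ i σ, f i σ ≤ f' i σ) (i : ι) :
    D.minExponent k f i ≤ D.minExponent k f' i :=
  (Finset.le_fold_min _).2 ⟨(Finset.fold_min_le _).2 (Or.inl le_rfl), fun σ hσ =>
    (D.minExponent_le k f i σ (by simpa using hσ)).trans (Nat.add_le_add_left (hf i σ) _)⟩

lemma mem_powSubgroup_iff {ι G : Type*} [AddCommGroup G] (D : PrimaryDecomposition ι G)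
    (t : ι → ℕ) (x : G) :
    x ∈ D.powSubgroup t ↔ ∀ i, (D.p i : ZMod (D.p i ^ D.r i)) ^ t i ∣ D.equiv x i := by
  simp only [powSubgroup, AddSubgroup.mem_comap, AddSubgroup.mem_pi, Set.mem_univ, true_imp_iff,
    ZMod.mem_zmultiples_iff_dvd]
  rfl

lemma subgroupEtaTheta_le (D : PrimaryDecomposition ι G) (k : D.pairs → ℕ) (η : D.Eta)
    (θ : D.Theta) : D.subgroupEtaTheta k η θ ≤ D.subgroupEta k η := by
  intro x hx
  rw [subgroupEta, mem_powSubgroup_iff]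
  rw [subgroupEtaTheta, mem_powSubgroup_iff] at hx
  exact fun i => (pow_dvd_pow _
    (D.minExponent_mono k (fun i σ => Nat.le_add_right _ _) i)).trans (hx i)

/-- The coefficients that determine a random homomorphism from the message group to `G`: one
element of the ring with index `i` for every cyclic summand of the message group that belongs to
the same prime. -/
abbrev Coefficients (D : PrimaryDecomposition ι G) (k : D.pairs → ℕ) : Type _ :=
  (i : ι) → (σ : {σ : D.pairs // σ.1.1 = D.p i}) → Fin (k σ.1) → ZMod (D.p i ^ D.r i)

instance neZero_pow_p (D : PrimaryDecomposition ι G) (i : ι) : NeZero (D.p i ^ D.r i) :=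
  ⟨pow_ne_zero _ (D.prime i).ne_zero⟩

/-- Multiplication by `p ^ (|r - s|⁺ + e) * x` is well defined as a map from `ZMod (p ^ s)` to
`ZMod (p ^ r)`, because `s + |r - s|⁺ ≥ r`. -/
lemma natCast_pow_mul_eq_zero (D : PrimaryDecomposition ι G) (i : ι)
    (σ : {σ : D.pairs // σ.1.1 = D.p i}) (e : ℕ) (x : ZMod (D.p i ^ D.r i)) :
    ((σ.1.1.1 ^ σ.1.1.2 : ℕ) : ZMod (D.p i ^ D.r i)) *
      (((D.p i ^ (D.r i - σ.1.1.2 + e) : ℕ) : ZMod (D.p i ^ D.r i)) * x) = 0 := by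
  rw [← mul_assoc, ← Nat.cast_mul, σ.2, ← pow_add,
    (ZMod.natCast_eq_zero_iff _ _).2 (pow_dvd_pow _ (by omega)), zero_mul]

/-- The homomorphism from the message group to `G` whose component with index `i` is
`∑_{s,j} p ^ (|r - s|⁺ + η_s) a_{s,j} g_{s,j}`. -/
def codeHom (D : PrimaryDecomposition ι G) (k : D.pairs → ℕ) (η : D.Eta)
    (g : D.Coefficients k) : D.MessageGroup k →+ G :=
  D.equiv.symm.toAddMonoidHom.comp <| AddMonoidHom.mk'
    (fun a i => ∑ σ, ∑ j, ZMod.mulHom _ (D.natCast_pow_mul_eq_zero i σ (η i σ) (g i σ j))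
      (a σ.1 j))
    (fun a b => by
      ext i
      simp only [Pi.add_apply, map_add, Finset.sum_add_distrib])

lemma equiv_codeHom_apply (D : PrimaryDecomposition ι G) (k : D.pairs → ℕ) (η : D.Eta)
    (g : D.Coefficients k) (a : D.MessageGroup k) (i : ι) :
    D.equiv (D.codeHom k η g a) i = ∑ σ : {σ : D.pairs // σ.1.1 = D.p i}, ∑ j,
      (((a σ.1 j).val * D.p i ^ (D.r i - σ.1.1.2 + η i σ) : ℕ) : ZMod (D.p i ^ D.r i)) *
        g i σ j := by
  have h : D.equiv (D.codeHom k η g a) i =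
      ∑ σ : {σ : D.pairs // σ.1.1 = D.p i}, ∑ j,
        ZMod.mulHom _ (D.natCast_pow_mul_eq_zero i σ (η i σ) (g i σ j)) (a σ.1 j) := by
    simp [codeHom]
  rw [h]
  refine Finset.sum_congr rfl fun σ _ => Finset.sum_congr rfl fun j _ => ?_
  rw [ZMod.mulHom_apply, Nat.cast_mul, mul_assoc]

/-- The value of `codeHom` at a fixed message `a`, as a homomorphism in the coefficients. -/
def codewordHom (D : PrimaryDecomposition ι G) (k : D.pairs → ℕ) (η : D.Eta)
    (a : D.MessageGroup k) : D.Coefficients k →+ G :=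
  AddMonoidHom.mk' (fun g => D.codeHom k η g a) fun g g' => D.equiv.injective <| by
    ext i
    simp only [map_add, Pi.add_apply, equiv_codeHom_apply, mul_add, Finset.sum_add_distrib]

/-- As the coefficients vary, the codeword of a message of type `θ̂` runs over `H_{η+θ̂}`. The
components of the message with exponent `s` are divisible by `p ^ θ̂_s` and one of them by no higher
power, so the least of the `|r - s|⁺ + η_s + θ̂_s` decides. -/
lemma range_codewordHom (D : PrimaryDecomposition ι G) (k : D.pairs → ℕ) (η : D.Eta)
    (a : D.MessageGroup k) :
    (D.codewordHom k η a).range = D.subgroupEtaTheta k η (D.typeOf a) := by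
  have ha : ∀ σ : D.pairs, a σ ∈ layer σ.1.1 σ.1.2 (k σ) (D.typeOf a σ) := fun σ => by
    simpa using (D.mem_typeSet_zero_iff a _).2 rfl σ
  have hθ : ∀ σ : D.pairs, (D.typeOf a σ : ℕ) ≤ σ.1.2 := fun σ =>
    Nat.lt_succ_iff.1 (D.typeOf a σ).2
  set t := D.minExponent k fun i σ => (η i σ : ℕ) + (D.typeOf a σ.1 : ℕ) with ht
  have h1 : ∀ i (σ : {σ : D.pairs // σ.1.1 = D.p i}) (j : Fin (k σ.1)),
      D.p i ^ t i ∣ (a σ.1 j).val * D.p i ^ (D.r i - σ.1.1.2 + η i σ) := by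
    intro i σ j
    have hle := D.minExponent_le k (fun i σ => (η i σ : ℕ) + (D.typeOf a σ.1 : ℕ)) i σ
      (Fin.pos j).ne'
    have hdvd := ((mem_layer_iff (hθ σ.1) _).1 (ha σ.1)).1 j
    have e : σ.1.1.1 ^ (D.typeOf a σ.1 : ℕ) = D.p i ^ (D.typeOf a σ.1 : ℕ) := by rw [σ.2]
    rw [e] at hdvd
    refine (pow_dvd_pow _ ?_).trans (pow_add (D.p i) _ _ ▸ mul_dvd_mul_right hdvd _)
    rw [ht]
    omega
  have h2 : ∀ i, t i < D.r i → ∃ (σ : {σ : D.pairs // σ.1.1 = D.p i}) (j : Fin (k σ.1)) (m : ℕ),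
      (a σ.1 j).val * D.p i ^ (D.r i - σ.1.1.2 + η i σ) = D.p i ^ t i * m ∧ ¬ D.p i ∣ m := by
    intro i hi
    obtain ⟨σ, -, hσ⟩ := D.exists_eq_minExponent k _ i hi
    have hl := (mem_layer_iff (hθ σ.1) _).1 (ha σ.1)
    have hlt : (D.typeOf a σ.1 : ℕ) < σ.1.1.2 := by
      have : t i < D.r i := hi
      rw [ht] at this
      omega
    obtain ⟨j, hj⟩ := hl.2 hlt
    have hdvd := hl.1 j
    have e : ∀ n, σ.1.1.1 ^ n = D.p i ^ n := fun n => by rw [σ.2]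
    rw [e] at hj hdvd
    obtain ⟨m, hm⟩ := hdvd
    refine ⟨σ, j, m, ?_, fun hpm => hj ?_⟩
    · rw [ht, hσ, hm, mul_right_comm, ← pow_add]
      congr 2
      omega
    · rw [hm, pow_succ]
      exact mul_dvd_mul_left _ hpm
  ext x
  rw [subgroupEtaTheta, mem_powSubgroup_iff]
  simp only [AddMonoidHom.mem_range, ← ht, ← ZMod.exists_sum_mul_eq_iff (D.prime _) (h1 _) (h2 _),
    Classical.skolem]
  refine exists_congr fun g => ?_
  rw [← D.equiv.injective.eq_iff, funext_iff]
  simp only [← equiv_codeHom_apply]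
  rfl

lemma codeHom_mem_subgroupEta (D : PrimaryDecomposition ι G) (k : D.pairs → ℕ) (η : D.Eta)
    (g : D.Coefficients k) (a : D.MessageGroup k) : D.codeHom k η g a ∈ D.subgroupEta k η := by
  refine D.subgroupEtaTheta_le k η (D.typeOf a) ?_
  rw [← range_codewordHom]
  exact ⟨g, rfl⟩

end PrimaryDecomposition

/-! ### Averages over cosets and random coding -/

/-- The values of a homomorphism are uniformly distributed on its range. -/
lemma AddMonoidHom.card_mul_sum_comp {Γ A : Type*} [AddGroup Γ] [AddGroup A] [Fintype Γ] [Fintype A]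
    (f : Γ →+ A) [DecidablePred (· ∈ f.range)] (F : A → ℝ) :
    (Nat.card f.range : ℝ) * ∑ γ, F (f γ) = Fintype.card Γ * ∑ x : A with x ∈ f.range, F x := by
  classical
  have hfib : ∀ x ∈ ({x : A | x ∈ f.range} : Finset A),
      ∑ γ with f γ = x, F (f γ) = (Nat.card f.ker : ℝ) * F x := by
    intro x hx
    obtain ⟨γ₀, rfl⟩ := (Finset.mem_filter.1 hx).2
    rw [Finset.sum_congr rfl (g := fun _ => F (f γ₀)) fun γ hγ => by rw [(Finset.mem_filter.1 hγ).2],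
      Finset.sum_const, nsmul_eq_mul]
    congr 2
    rw [AddMonoidHom.card_fiber_eq_of_mem_range f (y := 0) ⟨γ₀, rfl⟩ ⟨0, map_zero f⟩,
      Nat.card_eq_fintype_card, Fintype.card_subtype]
    simp only [AddMonoidHom.mem_ker]
  have hcard : (Fintype.card Γ : ℝ) = Nat.card f.range * Nat.card f.ker := by
    rw [← Nat.card_eq_fintype_card, ← Nat.cast_mul, mul_comm, ← AddSubgroup.index_ker]
    rw [AddSubgroup.card_mul_index]
  rw [← Finset.sum_fiberwise_of_maps_to (t := {x : A | x ∈ f.range}) (g := f) (fun γ _ => by simp),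
    Finset.sum_congr rfl hfib, ← Finset.mul_sum, hcard, mul_assoc]

namespace PrimaryDecomposition

section CosetAverage

variable {G : Type*} [AddCommGroup G] [Fintype G]

open Classical in
/-- The average of `f` over the coset `H + b`. -/
def cosetAverage (H : AddSubgroup G) (b : G) (f : G → ℝ) : ℝ :=
  (Nat.card H : ℝ)⁻¹ * ∑ x : G with x - b ∈ H, f x

lemma sum_coset_eq (H : AddSubgroup G) (b : G) (f : G → ℝ) [DecidablePred fun x => x - b ∈ H] :
    ∑ x : G with x - b ∈ H, f x = Nat.card H * cosetAverage H b f := by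
  have hH : (Nat.card H : ℝ) ≠ 0 := Nat.cast_ne_zero.2 Nat.card_pos.ne'
  rw [cosetAverage, mul_inv_cancel_left₀ hH]
  congr!

lemma cosetAverage_add_left (H : AddSubgroup G) (b : G) (f : G → ℝ) {h : G} (hh : h ∈ H) :
    cosetAverage H b (fun x => f (h + x)) = cosetAverage H b f := by
  classical
  rw [cosetAverage, cosetAverage]
  congr 1
  refine Finset.sum_equiv (Equiv.addLeft h) (fun x => ?_) (fun x _ => rfl)
  simp only [Finset.mem_filter, Finset.mem_univ, true_and, Equiv.coe_addLeft]
  rw [add_sub_assoc, H.add_mem_cancel_left hh]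

lemma cosetAverage_add (H : AddSubgroup G) (b : G) (f f' : G → ℝ) :
    cosetAverage H b (fun x => f x + f' x) = cosetAverage H b f + cosetAverage H b f' := by
  rw [cosetAverage, cosetAverage, cosetAverage, Finset.sum_add_distrib, mul_add]

lemma cosetAverage_nonneg (H : AddSubgroup G) (b : G) {f : G → ℝ} (hf : ∀ x, 0 ≤ f x) :
    0 ≤ cosetAverage H b f :=
  mul_nonneg (by positivity) (Finset.sum_nonneg fun x _ => hf x)

lemma cosetAverage_sum {A : Type*} (s : Finset A) (H : AddSubgroup G) (b : G) (f : A → G → ℝ) :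
    cosetAverage H b (fun x => ∑ a ∈ s, f a x) = ∑ a ∈ s, cosetAverage H b (f a) := by
  simp only [cosetAverage]
  rw [Finset.sum_comm, Finset.mul_sum]

lemma cosetAverage_const_mul (H : AddSubgroup G) (b : G) (r : ℝ) (f : G → ℝ) :
    cosetAverage H b (fun x => r * f x) = r * cosetAverage H b f := by
  rw [cosetAverage, cosetAverage, ← Finset.mul_sum, mul_left_comm]

lemma cosetAverage_const (H : AddSubgroup G) (b : G) (r : ℝ) :
    cosetAverage H b (fun _ => r) = r := by
  classical
  have hH : (Nat.card H : ℝ) ≠ 0 := Nat.cast_ne_zero.2 Nat.card_pos.ne'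
  have hcard : ((Finset.univ.filter fun x : G => x - b ∈ H).card : ℝ) = Nat.card H := by
    rw [Nat.card_eq_fintype_card, ← Fintype.card_subtype]
    exact_mod_cast Fintype.card_congr ((Equiv.subRight b).subtypeEquiv fun x => Iff.rfl)
  have : cosetAverage H b (fun _ => r) = (Nat.card H : ℝ)⁻¹ *
      (((Finset.univ.filter fun x : G => x - b ∈ H).card : ℝ) * r) := by
    rw [cosetAverage, Finset.sum_const, nsmul_eq_mul]
  rw [this, hcard, inv_mul_cancel_left₀ hH]

end CosetAverage

variable {ι G : Type*} [Fintype ι] [AddCommGroup G] [Fintype G]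

/-- The image of a message of type `θ̂` under the random homomorphism is uniformly distributed on
`H_{η+θ̂}`, since the image is additive in the coefficients. -/
lemma sum_codeHom_add (D : PrimaryDecomposition ι G) (k : D.pairs → ℕ)
    [Fintype (D.Coefficients k)] (η : D.Eta)
    (d : D.MessageGroup k) (f : G → ℝ) (x : G) :
    ∑ g : D.Coefficients k, f (D.codeHom k η g d + x) = Fintype.card (D.Coefficients k) *
      cosetAverage (D.subgroupEtaTheta k η (D.typeOf d)) x f := by
  classical
  have h := (D.codewordHom k η d).card_mul_sum_comp (fun y => f (y + x))
  have hcard : (Nat.card (D.codewordHom k η d).range : ℝ) ≠ 0 :=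
    Nat.cast_ne_zero.2 Nat.card_pos.ne'
  have hsum : ∑ y : G with y ∈ (D.codewordHom k η d).range, f (y + x) =
      ∑ y : G with y - x ∈ (D.codewordHom k η d).range, f y :=
    Finset.sum_equiv (Equiv.addRight x) (fun y => by simp) (fun y _ => rfl)
  rw [hsum, sum_coset_eq, mul_left_comm] at h
  rw [← range_codewordHom]
  exact mul_left_cancel₀ hcard h

/-- Random coding: if the coefficients of the homomorphism are uniform and the shift is uniform on
`H_η + b`, then every codeword `x` is uniform on `H_η + b`, and given `x` the codeword of another
message is uniform on `x + H_{η+θ̂}`, where `θ̂` is the type of the difference of the messages. Some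
choice is at least as good as the average. -/
lemma exists_code_sum_le (D : PrimaryDecomposition ι G) (k : D.pairs → ℕ) (η : D.Eta) (b : G)
    (e : G → ℝ) (w : G → G → ℝ) :
    ∃ (φ : D.MessageGroup k →+ G) (v : G),
      ∑ a, (e (φ a + v) + ∑ a' with a' ≠ a, w (φ a' + v) (φ a + v)) ≤
        Fintype.card (D.MessageGroup k) * (cosetAverage (D.subgroupEta k η) b e +
          ∑ θ : D.Theta with θ ≠ D.fullTheta, (D.typeCard k θ : ℝ) *
            cosetAverage (D.subgroupEta k η) b fun x =>
              cosetAverage (D.subgroupEtaTheta k η θ) x fun x' => w x' x) := by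
  classical
  set H := D.subgroupEta k η
  set B := cosetAverage H b e + ∑ θ : D.Theta with θ ≠ D.fullTheta, (D.typeCard k θ : ℝ) *
    cosetAverage H b fun x => cosetAverage (D.subgroupEtaTheta k η θ) x fun x' => w x' x with hB
  -- the contribution of one message to the average over all codes
  have hmsg : ∀ a : D.MessageGroup k, ∑ g : D.Coefficients k, cosetAverage H b (fun v =>
      e (D.codeHom k η g a + v) +
        ∑ a' with a' ≠ a, w (D.codeHom k η g a' + v) (D.codeHom k η g a + v)) =
      Fintype.card (D.Coefficients k) * B := by
    intro a
    have hshift : ∀ g, cosetAverage H b (fun v => e (D.codeHom k η g a + v) +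
        ∑ a' with a' ≠ a, w (D.codeHom k η g a' + v) (D.codeHom k η g a + v)) =
        cosetAverage H b e + cosetAverage H b fun x =>
          ∑ d : D.MessageGroup k with d ≠ 0, w (D.codeHom k η g d + x) x := by
      intro g
      rw [← cosetAverage_add]
      refine Eq.trans ?_ (cosetAverage_add_left H b _ (D.codeHom_mem_subgroupEta k η g a))
      congr 1
      ext v
      congr 1
      refine Finset.sum_equiv (Equiv.subRight a) (fun a' => by simp [sub_eq_zero]) fun a' _ => ?_
      rw [Equiv.subRight_apply, map_sub, ← add_assoc, sub_add_cancel]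
    rw [Finset.sum_congr rfl fun g _ => hshift g, Finset.sum_add_distrib, Finset.sum_const,
      Finset.card_univ, nsmul_eq_mul, hB, mul_add, ← cosetAverage_sum]
    congr 1
    rw [← D.sum_ne_zero_eq_sum_typeCard k, ← cosetAverage_sum, ← cosetAverage_const_mul]
    congr 1
    ext x
    rw [Finset.sum_comm, Finset.mul_sum]
    exact Finset.sum_congr rfl fun d _ => D.sum_codeHom_add k η d (fun x' => w x' x) x
  have htotal : ∑ g : D.Coefficients k, ∑ v : G with v - b ∈ H,
      ∑ a, (e (D.codeHom k η g a + v) +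
        ∑ a' with a' ≠ a, w (D.codeHom k η g a' + v) (D.codeHom k η g a + v)) =
      ∑ g : D.Coefficients k, ∑ v : G with v - b ∈ H,
        (Fintype.card (D.MessageGroup k) * B) := by
    simp only [sum_coset_eq, cosetAverage_const, cosetAverage_sum]
    rw [← Finset.mul_sum, Finset.sum_comm, Finset.sum_congr rfl fun a _ => hmsg a]
    simp only [Finset.sum_const, Finset.card_univ, nsmul_eq_mul]
    ring
  obtain ⟨g, -, hg⟩ := Finset.exists_le_of_sum_le Finset.univ_nonempty htotal.le
  have hne : (Finset.univ.filter fun v : G => v - b ∈ H).Nonempty := ⟨b, by simp [H.zero_mem]⟩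
  obtain ⟨v, -, hv⟩ := Finset.exists_le_of_sum_le hne hg
  exact ⟨D.codeHom k η g, v, hv⟩

end PrimaryDecomposition

/-! ### Tests on the joint system and achievability -/

section Test

variable {G N : Type*} [Fintype G] [DecidableEq G] [Fintype N]

/-- The diagonal block at `x` of a test on the joint system: the test on the channel output after
the classical register has been found in the state `x`. -/
def outputTest (Λ : Matrix (G × N) (G × N) ℂ) (x : G) : Matrix N N ℂ :=
  Λ.submatrix (Prod.mk x) (Prod.mk x)

lemma posSemidef_outputTest {G N : Type*} {Λ : Matrix (G × N) (G × N) ℂ} (hΛ : Λ.PosSemidef)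
    (x : G) : (outputTest Λ x).PosSemidef :=
  hΛ.submatrix _

lemma trace_mul_single_kronecker (Λ : Matrix (G × N) (G × N) ℂ) (x : G) (A : Matrix N N ℂ) :
    (Λ * (Matrix.single x x (1 : ℂ) ⊗ₖ A)).trace = (outputTest Λ x * A).trace := by
  simp only [Matrix.trace, Matrix.diag_apply, Matrix.mul_apply, Fintype.sum_prod_type,
    Matrix.kroneckerMap_apply, Matrix.single_apply, outputTest, Matrix.submatrix_apply]
  rw [Finset.sum_eq_single x (fun y _ hy => by simp [hy.symm]) (by simp)]
  refine Finset.sum_congr rfl fun n _ => ?_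
  rw [Finset.sum_eq_single x (fun y _ hy => by simp [hy.symm]) (by simp)]
  simp

variable {ι : Type*} [Fintype ι] [AddCommGroup G]

lemma trace_mul_cosetState_re (ρ : G → Matrix N N ℂ) (H : AddSubgroup G) (b : G)
    (Λ : Matrix (G × N) (G × N) ℂ) :
    (Λ * cosetState ρ H b).trace.re =
      PrimaryDecomposition.cosetAverage H b fun x => (outputTest Λ x * ρ x).trace.re := by
  rw [cosetState, PrimaryDecomposition.cosetAverage, Finset.mul_sum, Matrix.trace_sum,
    Complex.re_sum, Finset.mul_sum]
  refine Finset.sum_congr rfl fun x _ => ?_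
  rw [Matrix.mul_smul, Matrix.trace_smul, trace_mul_single_kronecker, smul_eq_mul,
    ← Complex.ofReal_natCast, ← Complex.ofReal_inv, Complex.re_ofReal_mul]

lemma trace_mul_conditionedState_re (ρ : G → Matrix N N ℂ) (H K : AddSubgroup G) (b : G)
    (Λ : Matrix (G × N) (G × N) ℂ) :
    (Λ * conditionedState ρ H K b).trace.re =
      PrimaryDecomposition.cosetAverage H b fun x =>
        PrimaryDecomposition.cosetAverage K x fun x' => (outputTest Λ x' * ρ x).trace.re := by
  rw [conditionedState, PrimaryDecomposition.cosetAverage, Finset.mul_sum, Matrix.trace_sum,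
    Complex.re_sum, Finset.mul_sum]
  refine Finset.sum_congr rfl fun x _ => ?_
  rw [PrimaryDecomposition.cosetAverage, Finset.mul_sum, Matrix.trace_sum, Complex.re_sum,
    ← mul_assoc, Finset.mul_sum]
  refine Finset.sum_congr rfl fun x' _ => ?_
  rw [Matrix.mul_smul, Matrix.trace_smul, trace_mul_single_kronecker, smul_eq_mul,
    ← Complex.ofReal_natCast, ← Complex.ofReal_natCast, ← Complex.ofReal_inv,
    ← Complex.ofReal_inv, ← Complex.ofReal_mul, Complex.re_ofReal_mul]

lemma trace_mul_mixtureState_re (D : PrimaryDecomposition ι G) (k : D.pairs → ℕ)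
    (ρ : G → Matrix N N ℂ) (η : D.Eta) (b : G) (Λ : Matrix (G × N) (G × N) ℂ) :
    (Λ * mixtureState D k ρ η b).trace.re = ((Fintype.card (D.MessageGroup k) : ℝ) - 1)⁻¹ *
      ∑ θ : D.Theta with θ ≠ D.fullTheta, (D.typeCard k θ : ℝ) *
        PrimaryDecomposition.cosetAverage (D.subgroupEta k η) b fun x =>
          PrimaryDecomposition.cosetAverage (D.subgroupEtaTheta k η θ) x fun x' =>
            (outputTest Λ x' * ρ x).trace.re := by
  have h : ((Fintype.card (D.MessageGroup k) : ℂ) - 1)⁻¹ =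
      (((Fintype.card (D.MessageGroup k) : ℝ) - 1)⁻¹ : ℝ) := by push_cast; rfl
  rw [mixtureState, Matrix.mul_smul, Matrix.trace_smul, smul_eq_mul, h, Complex.re_ofReal_mul,
    Finset.mul_sum, Matrix.trace_sum, Complex.re_sum]
  congr 1
  refine Finset.sum_congr rfl fun θ _ => ?_
  rw [Matrix.mul_smul, Matrix.trace_smul, smul_eq_mul, ← Complex.ofReal_natCast,
    Complex.re_ofReal_mul, trace_mul_conditionedState_re]

lemma trace_jointState_re [DecidableEq N] (D : PrimaryDecomposition ι G) (k : D.pairs → ℕ)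
    {ρ : G → Matrix N N ℂ} (hρ : ∀ x, IsDensity (ρ x)) (η : D.Eta) (b : G) :
    (jointState D k ρ η b).trace.re = 1 := by
  have h1 : ∀ x : G, outputTest (1 : Matrix (G × N) (G × N) ℂ) x = 1 := fun x =>
    Matrix.submatrix_one _ (Prod.mk_right_injective x)
  have h := trace_mul_cosetState_re ρ (D.subgroupEta k η) b 1
  simp only [h1, one_mul, (hρ _).2, Complex.one_re, PrimaryDecomposition.cosetAverage_const] at h
  exact h

lemma trace_mul_mixtureState_re_nonneg (D : PrimaryDecomposition ι G) (k : D.pairs → ℕ)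
    {ρ : G → Matrix N N ℂ} (hρ : ∀ x, IsDensity (ρ x)) (η : D.Eta) (b : G)
    {Λ : Matrix (G × N) (G × N) ℂ} (hΛ : Λ.PosSemidef) :
    0 ≤ (Λ * mixtureState D k ρ η b).trace.re := by
  classical
  have hJ : (1 : ℝ) ≤ Fintype.card (D.MessageGroup k) :=
    Nat.one_le_cast.2 (Nat.succ_le_of_lt Fintype.card_pos)
  rw [trace_mul_mixtureState_re]
  refine mul_nonneg (inv_nonneg.2 (sub_nonneg.2 hJ)) (Finset.sum_nonneg fun θ _ =>
    mul_nonneg (Nat.cast_nonneg _) ?_)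
  exact PrimaryDecomposition.cosetAverage_nonneg _ _ fun x =>
    PrimaryDecomposition.cosetAverage_nonneg _ _ fun x' =>
      trace_mul_re_nonneg (posSemidef_outputTest hΛ x') (hρ x).1

end Test

section Achievability

variable {ι G N : Type*} [Fintype ι] [AddCommGroup G] [Fintype G] [DecidableEq G]
  [Fintype N] [DecidableEq N]

/-- A test whose errors of the two kinds are small enough gives a code. The constant
`c = (ε' - ε) / (ε' + ε)` in the operator inequality is the optimal one. -/
lemma exists_system_of_test (D : PrimaryDecomposition ι G) (k : D.pairs → ℕ)
    (hk : ∃ σ, k σ ≠ 0) (ρ : G → Matrix N N ℂ) (hρ : ∀ x, IsDensity (ρ x)) {ε ε' : ℝ}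
    (hε : 0 < ε) (hε' : ε < ε') (η : D.Eta) (b : G) (Λ : Matrix (G × N) (G × N) ℂ)
    (hΛ : Λ.PosSemidef) (hΛ1 : (1 - Λ).PosSemidef)
    (h1 : 1 - ε ≤ (Λ * jointState D k ρ η b).trace.re)
    (h2 : ((Fintype.card (D.MessageGroup k) : ℝ) - 1) *
      (Λ * mixtureState D k ρ η b).trace.re < (ε' - ε) ^ 2 / (4 * ε')) :
    ∃ S : GroupTransmissionSystem (D.MessageGroup k) G N, S.errorProb ρ ≤ ε' := by
  have hJ : (1 : ℝ) < Fintype.card (D.MessageGroup k) :=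
    Nat.one_lt_cast.2 (D.one_lt_card_messageGroup hk)
  rw [trace_mul_mixtureState_re, mul_inv_cancel_left₀ (sub_pos.2 hJ).ne'] at h2
  rw [jointState, trace_mul_cosetState_re] at h1
  set A := outputTest Λ
  have hApos : ∀ x, (A x).PosSemidef := fun x => posSemidef_outputTest hΛ x
  have hA1 : ∀ x, (1 - A x).PosSemidef := fun x => by
    have := hΛ1.submatrix (Prod.mk x)
    rwa [Matrix.submatrix_sub, Pi.sub_apply, Pi.sub_apply,
      Matrix.submatrix_one _ (Prod.mk_right_injective x)] at this
  set c := (ε' - ε) / (ε' + ε) with hc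
  have hcpos : 0 < c := div_pos (by linarith) (by linarith)
  set y := (ε' - ε) ^ 2 / (4 * ε') with hy
  set X := ∑ θ : D.Theta with θ ≠ D.fullTheta, (D.typeCard k θ : ℝ) *
        PrimaryDecomposition.cosetAverage (D.subgroupEta k η) b fun x =>
          PrimaryDecomposition.cosetAverage (D.subgroupEtaTheta k η θ) x fun x' =>
            (A x' * ρ x).trace.re with hX
  set δ := y - X with hδ
  have hδpos : 0 < δ := sub_pos.2 h2
  set C := 2 + c + c⁻¹ with hC
  obtain ⟨φ, v, hφ⟩ := D.exists_code_sum_le k η b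
    (fun x => (1 + c + C * δ) + -(1 + c) * (A x * ρ x).trace.re)
    (fun x' x => C * (A x' * ρ x).trace.re)
  simp only [PrimaryDecomposition.cosetAverage_add, PrimaryDecomposition.cosetAverage_const,
    PrimaryDecomposition.cosetAverage_const_mul, mul_left_comm _ C, ← Finset.mul_sum] at hφ
  rw [← hX] at hφ
  obtain ⟨P, hP, hPsum, hPerr⟩ := exists_povm_one_sub_trace_le (J := D.MessageGroup k)
    (A := fun a => A (φ a + v)) (fun a => hApos _) (fun a => hA1 _) hcpos hδpos
  refine ⟨⟨φ, v, P, hP, hPsum⟩, ?_⟩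
  rw [GroupTransmissionSystem.errorProb, ← Finset.mul_sum, one_div,
    inv_mul_le_iff₀ (zero_lt_one.trans hJ)]
  refine (Finset.sum_le_sum fun a _ => hPerr a _ (hρ _)).trans ?_
  have hbound : (1 + c + C * δ) + -(1 + c) * (PrimaryDecomposition.cosetAverage
      (D.subgroupEta k η) b fun x => (A x * ρ x).trace.re) + C * X ≤ ε' := by
    have hval : (1 + c) * ε + C * y = ε' := by
      have : ε' - ε ≠ 0 := (sub_pos.2 hε').ne'
      have : ε' + ε ≠ 0 := by linarith
      have : ε' ≠ 0 := (hε.trans hε').ne'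
      rw [hC, hy, hc]
      field_simp
      ring
    have := mul_le_mul_of_nonneg_left h1 (by positivity : 0 ≤ 1 + c)
    rw [← hval, hδ]
    linarith
  refine le_trans (le_of_eq (Finset.sum_congr rfl fun a _ => ?_))
    (hφ.trans (mul_le_mul_of_nonneg_left hbound (zero_lt_one.trans hJ).le))
  rw [hC, GroupTransmissionSystem.encode]
  ring

/-- A state with large hypothesis testing entropy has a test with small error of the second
kind. -/
lemma exists_test_of_le_hypothesisTestingEntropy {M : Type*} [Fintype M] [DecidableEq M]
    {ε R y : ℝ} {π σ : Matrix M M ℂ} (hε : 0 ≤ ε) (hπ : π.trace.re = 1)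
    (hσ : ∀ Λ : Matrix M M ℂ, Λ.PosSemidef → 0 ≤ (Λ * σ).trace.re)
    (h : (R : EReal) ≤ hypothesisTestingEntropy ε π σ) (hy : (2 : ℝ) ^ (-R) < y) :
    ∃ Λ : Matrix M M ℂ, Λ.PosSemidef ∧ (1 - Λ).PosSemidef ∧ 1 - ε ≤ (Λ * π).trace.re ∧
      (Λ * σ).trace.re < y := by
  set s := {x : ℝ | ∃ Λ : Matrix M M ℂ, Λ.PosSemidef ∧ (1 - Λ).PosSemidef ∧
    1 - ε ≤ (Λ * π).trace.re ∧ x = (Λ * σ).trace.re} with hs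
  have hne : s.Nonempty := ⟨_, 1, Matrix.PosSemidef.one, by simpa using Matrix.PosSemidef.zero,
    by rw [one_mul, hπ]; linarith, rfl⟩
  have hlt : optimalTypeTwo ε π σ < y := by
    rw [hypothesisTestingEntropy] at h
    split_ifs at h with h0
    · rw [h0]
      exact (Real.rpow_pos_of_pos two_pos _).trans hy
    · have hnn : 0 ≤ optimalTypeTwo ε π σ := by
        refine Real.sInf_nonneg ?_
        rintro x ⟨Λ, hΛ, -, -, rfl⟩
        exact hσ Λ hΛ
      have hpos := lt_of_le_of_ne hnn (Ne.symm h0)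
      refine lt_of_le_of_lt ?_ hy
      rw [← Real.logb_le_iff_le_rpow one_lt_two hpos]
      linarith [EReal.coe_le_coe_iff.1 h]
  obtain ⟨x, ⟨Λ, hΛ, hΛ1, hΛπ, rfl⟩, hx⟩ := exists_lt_of_csInf_lt hne hlt
  exact ⟨Λ, hΛ, hΛ1, hΛπ, hx⟩

/-- Achievability: a message group whose rate is at most the bound has a code of error `ε'`. -/
lemma exists_system_of_le_rateBound (D : PrimaryDecomposition ι G) (k : D.pairs → ℕ)
    (hk : ∃ σ, k σ ≠ 0) (ρ : G → Matrix N N ℂ) (hρ : ∀ x, IsDensity (ρ x)) {ε ε' : ℝ}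
    (hε : 0 < ε) (hε' : ε < ε')
    (h : ((Real.logb 2 (Fintype.card (D.MessageGroup k)) : ℝ) : EReal) ≤ rateBound D k ρ ε ε') :
    ∃ S : GroupTransmissionSystem (D.MessageGroup k) G N, S.errorProb ρ ≤ ε' := by
  have hJ : (1 : ℝ) < Fintype.card (D.MessageGroup k) :=
    Nat.one_lt_cast.2 (D.one_lt_card_messageGroup hk)
  have hJ0 := zero_lt_one.trans hJ
  have hpos : 0 < 4 * ε' / (ε' - ε) ^ 2 :=
    div_pos (by linarith) (pow_pos (sub_pos.2 hε') 2)
  obtain ⟨η, hη⟩ := exists_eq_ciSup_of_finite (f := fun η : D.Eta => ⨆ b : G,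
    hypothesisTestingEntropy ε (jointState D k ρ η b) (mixtureState D k ρ η b))
  obtain ⟨b, hb⟩ := exists_eq_ciSup_of_finite (f := fun b : G =>
    hypothesisTestingEntropy ε (jointState D k ρ η b) (mixtureState D k ρ η b))
  rw [rateBound, ← hη, ← hb, EReal.le_sub_iff_add_le (by simp) (by simp), ← EReal.coe_add,
    ← Real.logb_mul hJ0.ne' hpos.ne'] at h
  obtain ⟨Λ, hΛ, hΛ1, hΛπ, hΛσ⟩ := exists_test_of_le_hypothesisTestingEntropy
    (y := (ε' - ε) ^ 2 / (4 * ε') / (Fintype.card (D.MessageGroup k) - 1)) hε.le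
    (trace_jointState_re D k hρ η b)
    (fun Λ hΛ => trace_mul_mixtureState_re_nonneg D k hρ η b hΛ) h (by
      -- the bound has `|J|` where the union bound has `|J| - 1`; this leaves room for `δ`
      rw [Real.rpow_neg two_pos.le, Real.rpow_logb two_pos (by norm_num) (by positivity), mul_inv,
        inv_div, mul_comm, ← div_eq_mul_inv]
      have hy : 0 < (ε' - ε) ^ 2 / (4 * ε') :=
        div_pos (pow_pos (sub_pos.2 hε') 2) (by linarith)
      exact div_lt_div_of_pos_left hy (sub_pos.2 hJ) (by linarith))
  refine exists_system_of_test D k hk ρ hρ hε hε' η b Λ hΛ hΛ1 hΛπ ?_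
  rwa [lt_div_iff₀' (sub_pos.2 hJ)] at hΛσ

end Achievability

end

theorem mainTheorem4 {ι G N : Type*} [Fintype ι] [AddCommGroup G] [Fintype G] [DecidableEq G]
    [Fintype N] [DecidableEq N] (D : PrimaryDecomposition ι G) (k : D.pairs → ℕ)
    (hk : ∃ σ, k σ ≠ 0) (ρ : G → Matrix N N ℂ) (hρ : ∀ x, IsDensity (ρ x)) :
    (∃ ε' ∈ Set.Icc (0 : ℝ) 1, ∃ S : GroupTransmissionSystem (D.MessageGroup k) G N,
      S.HasParameters ρ (Fintype.card (D.MessageGroup k)) ε' ∧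
      ∀ ε ∈ Set.Ioo 0 ε',
        ((Real.logb 2 (Fintype.card (D.MessageGroup k)) : ℝ) : EReal) ≥ rateBound D k ρ ε ε') ∧
    ∀ ε' ∈ Set.Ioo (0 : ℝ) 1, ∀ ε ∈ Set.Ioo 0 ε',
      ((Real.logb 2 (Fintype.card (D.MessageGroup k)) : ℝ) : EReal) ≤ rateBound D k ρ ε ε' →
      ∃ S : GroupTransmissionSystem (D.MessageGroup k) G N,
        S.HasParameters ρ (Fintype.card (D.MessageGroup k)) ε' := by
  refine ⟨?_, fun ε' _ ε hε h => ?_⟩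
  · -- `ε'` is the least error probability of all systems
    obtain ⟨S, hS⟩ :=
      GroupTransmissionSystem.exists_forall_errorProb_le (J := D.MessageGroup k) ρ
    refine ⟨S.errorProb ρ, S.errorProb_mem_Icc hρ, S, ⟨rfl, le_rfl⟩, fun ε hε => ?_⟩
    refine rateBound_le_of_forall_lt hε.1 hε.2 fun t ht => ?_
    by_contra hlt
    obtain ⟨S', hS'⟩ := exists_system_of_le_rateBound D k hk ρ hρ hε.1 ht.1 (not_le.1 hlt).le
    exact absurd ((hS S').trans hS') (not_le.2 ht.2)
  · obtain ⟨S, hS⟩ := exists_system_of_le_rateBound D k hk ρ hρ hε.1 hε.2 h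
    exact ⟨S, rfl, hS⟩
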